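/- For $s,k\in\mathbb N$, an $(s,k)$-puzzle is a set $P\subseteq\{1,2,3\}^k$ with $|P|=s$. A 3D graph $H$ with domain $U$ is given by its edge set $E(H)\subseteq U^3$. For $f\in\{0,1,2\}$ let $\pi_f:U^3\to U^2$ be the map that drops the first ($f=0$), second ($f=1$) or third ($f=2$) coordinate, and let $R_f=\pi_f(E(H))$. A set $S\subseteq U$ induces a simplification of $H$ via $R_f$ if $R_f\cap (S\times(U\setminus S))=\emptyset$ or $R_f\cap((U\setminus S)\times S)=\emptyset$; its result is the 3D graph obtained from $H$ by deleting every edge $e$ with $\pi_f(e)\in (S\times(U\setminus S))\cup((U\setminus S)\times S)$. We say that $H$ simplifies to $H'$ if $H'$ is obtained from $H$ by a finite (possibly empty) sequence of such simplifications, where the choice of $f$ and $S$ may vary from step to step and each step uses the projections of the current 3D graph. For a puzzle $P$ let $H_P$ be the 3D graph with domain $P$ whose edges are the triples $(u,v,w)\in P^3$ for which there is no $i\in\{1,\dots,k\}$ such that exactly two of $u_i=1$, $v_i=2$, $w_i=3$ hold. The puzzle $P$ is a simplifiable SUSP (strong uniquely solvable puzzle) if $H_P$ simplifies to the trivial matching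 $\{(u,u,u): u\in P\}$. **Theorem.** There is a single algorithm which, given $s$, $k$ and an $(s,k)$-puzzle $P$ (as the list of its rows, in any order), decides whether $P$ is a simplifiable SUSP, and which runs in time polynomial in $s$ and $k$. Here an algorithm is a program for a random access machine with addition and truncated subtraction as its only arithmetic operations, and time is the number of steps executed. -/

import Mathlib

/-! ### Puzzles and their 3D graphs -/

/-- An `(s, k)`-puzzle: a set of `s` rows in `[3]^k`. The symbols `1, 2, 3` of `[3]` are the
elements `0, 1, 2` of `Fin 3`, in this order. -/
structure Puzzle (s k : ℕ) where
  rows : Finset (Fin k → Fin 3)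
  card_rows : rows.card = s

/-- A 2D graph with domain `U` (a bipartite graph on two disjoint copies of `U`), given by its
set of edges. -/
abbrev Graph2D (U : Type*) := Set (U × U)

/-- A 3D graph with domain `U` (a tripartite 3-uniform hypergraph on three disjoint copies of
`U`), given by its set of edges. -/
abbrev Graph3D (U : Type*) := Set (U × U × U)

/-- Exactly two of three propositions hold. -/
def ExactlyTwo (a b c : Prop) : Prop :=
  (a ∧ b ∧ ¬ c) ∨ (a ∧ ¬ b ∧ c) ∨ (¬ a ∧ b ∧ c)

namespace Puzzle

/-- The 3D graph `H_P` with domain `P`: the triple `(u, v, w)` of rows is an edge iff there is no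
column `i` such that exactly two of `u_i = 1`, `v_i = 2`, `w_i = 3` hold. -/
def graph {s k : ℕ} (P : Puzzle s k) : Graph3D P.rows :=
  {e | ¬ ∃ i : Fin k, ExactlyTwo (e.1.1 i = 0) (e.2.1.1 i = 1) (e.2.2.1 i = 2)}

end Puzzle

/-! ### Simplification -/

namespace Graph2D

/-- `S × (U - S)`. -/
def outCut {U : Type*} (S : Set U) : Set (U × U) := S ×ˢ Sᶜ

/-- `(U - S) × S`. -/
def inCut {U : Type*} (S : Set U) : Set (U × U) := Sᶜ ×ˢ S

/-- The set `S` induces a simplification of the 2D graph `G`. -/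
def Induces {U : Type*} (G : Graph2D U) (S : Set U) : Prop :=
  outCut S ∩ G = ∅ ∨ inCut S ∩ G = ∅

end Graph2D

namespace Graph3D

/-- The pair that remains of a triple after its coordinate number `f` is dropped. -/
def dropCoord {U : Type*} (f : Fin 3) (e : U × U × U) : U × U :=
  match f with
  | 0 => (e.2.1, e.2.2)
  | 1 => (e.1, e.2.2)
  | 2 => (e.1, e.2.1)

/-- The 2D graph `R_f`, obtained from `H` by projecting out coordinate number `f`. -/
def proj {U : Type*} (H : Graph3D U) (f : Fin 3) : Graph2D U :=
  dropCoord f '' H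

/-- The 3D graph left after deleting from `H` all edges that project, along coordinate `f`,
to a pair in `S × (U - S)` or in `(U - S) × S`. -/
def deleteCut {U : Type*} (H : Graph3D U) (f : Fin 3) (S : Set U) : Graph3D U :=
  H \ dropCoord f ⁻¹' (Graph2D.outCut S ∪ Graph2D.inCut S)

/-- One simplification step: some `S ⊆ U` induces a simplification of `H` to `H'` via one of the
current projections `R_0, R_1, R_2` of `H`. -/
def SimplifiesInOneStep {U : Type*} (H H' : Graph3D U) : Prop :=
  ∃ (f : Fin 3) (S : Set U), (H.proj f).Induces S ∧ H' = H.deleteCut f S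

/-- `H` simplifies to `H'`: there is a finite (possibly empty) series of simplification steps
from `H` to `H'`. -/
def SimplifiesTo {U : Type*} (H H' : Graph3D U) : Prop :=
  Relation.ReflTransGen SimplifiesInOneStep H H'

/-- The trivial matching `{(u, u, u) | u ∈ U}`. -/
def trivialMatching (U : Type*) : Graph3D U := {e | ∃ u : U, e = (u, u, u)}

end Graph3D

/-- A puzzle `P` is a simplifiable SUSP if `H_P` simplifies to the trivial matching. -/
def Puzzle.IsSimplifiableSUSP {s k : ℕ} (P : Puzzle s k) : Prop :=
  P.graph.SimplifiesTo (Graph3D.trivialMatching P.rows)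

/-! ### Random access machines -/

namespace RAM

/-- The state of a random access machine: registers, which a program refers to by name (hence
each program uses only finitely many of them), and a memory, which is addressed through
registers. -/
structure State where
  reg : ℕ → ℕ
  mem : ℕ → ℕ

/-- `r := n` for the register `r`. -/
def State.setReg (σ : State) (r n : ℕ) : State := { σ with reg := Function.update σ.reg r n }

/-- `mem[a] := n` for the address `a`. -/
def State.setMem (σ : State) (a n : ℕ) : State := { σ with mem := Function.update σ.mem a n }

/-- Programs. All arguments `r`, `a`, `b` are names of registers. The only arithmetic operations
are addition and (truncated) subtraction. -/
inductive Program where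
  | skip : Program
  /-- `r := n` -/
  | const (r n : ℕ) : Program
  /-- `r := a + b` -/
  | add (r a b : ℕ) : Program
  /-- `r := max (a - b) 0` -/
  | sub (r a b : ℕ) : Program
  /-- `r := mem[a]` -/
  | load (r a : ℕ) : Program
  /-- `mem[a] := b` -/
  | store (a b : ℕ) : Program
  /-- first `p`, then `q` -/
  | seq (p q : Program) : Program
  /-- if `r ≠ 0` then `p` else `q` -/
  | branch (r : ℕ) (p q : Program) : Program
  /-- while `r ≠ 0` do `p` -/
  | loop (r : ℕ) (p : Program) : Program

/-- `Run p σ t τ`: started in the state `σ`, the program `p` halts in the state `τ` after `t`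
time steps. Every elementary instruction and every evaluation of the test of a branch or of a
loop takes one step. (As addition and subtraction are the only arithmetic operations, in `t`
steps the bit length of the largest number grows by at most `t`; so polynomial time here is the
same as polynomial time with bit costs, or on Turing machines.) -/
inductive Run : Program → State → ℕ → State → Prop where
  | skip (σ : State) : Run .skip σ 1 σ
  | const (r n : ℕ) (σ : State) : Run (.const r n) σ 1 (σ.setReg r n)
  | add (r a b : ℕ) (σ : State) : Run (.add r a b) σ 1 (σ.setReg r (σ.reg a + σ.reg b))
  | sub (r a b : ℕ) (σ : State) : Run (.sub r a b) σ 1 (σ.setReg r (σ.reg a - σ.reg b))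
  | load (r a : ℕ) (σ : State) : Run (.load r a) σ 1 (σ.setReg r (σ.mem (σ.reg a)))
  | store (a b : ℕ) (σ : State) : Run (.store a b) σ 1 (σ.setMem (σ.reg a) (σ.reg b))
  | seq {p q : Program} {σ τ ρ : State} {t t' : ℕ} :
      Run p σ t τ → Run q τ t' ρ → Run (.seq p q) σ (t + t') ρ
  | branch_true {r : ℕ} {p : Program} (q : Program) {σ τ : State} {t : ℕ} :
      σ.reg r ≠ 0 → Run p σ t τ → Run (.branch r p q) σ (1 + t) τ
  | branch_false {r : ℕ} (p : Program) {q : Program} {σ τ : State} {t : ℕ} :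
      σ.reg r = 0 → Run q σ t τ → Run (.branch r p q) σ (1 + t) τ
  | loop_done {r : ℕ} (p : Program) {σ : State} :
      σ.reg r = 0 → Run (.loop r p) σ 1 σ
  | loop_step {r : ℕ} {p : Program} {σ τ ρ : State} {t t' : ℕ} :
      σ.reg r ≠ 0 → Run p σ t τ → Run (.loop r p) τ t' ρ → Run (.loop r p) σ (1 + t + t') ρ

/-- The machine is deterministic: running time and final state are determined by the program
and the initial state. -/
theorem Run.unique {p : Program} {σ τ τ' : State} {t t' : ℕ}
    (h : Run p σ t τ) (h' : Run p σ t' τ') : t = t' ∧ τ = τ' := by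
  induction h generalizing t' τ' with
  | skip | const | add | sub | load | store => cases h'; exact ⟨rfl, rfl⟩
  | seq _ _ ih₁ ih₂ =>
    cases h' with
    | seq k₁ k₂ =>
      obtain ⟨rfl, rfl⟩ := ih₁ k₁
      obtain ⟨rfl, rfl⟩ := ih₂ k₂
      exact ⟨rfl, rfl⟩
  | branch_true _ hr _ ih =>
    cases h' with
    | branch_true _ _ k => obtain ⟨rfl, rfl⟩ := ih k; exact ⟨rfl, rfl⟩
    | branch_false _ hr' _ => exact absurd hr' hr
  | branch_false _ hr _ ih =>
    cases h' with
    | branch_true _ hr' _ => exact absurd hr hr'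
    | branch_false _ _ k => obtain ⟨rfl, rfl⟩ := ih k; exact ⟨rfl, rfl⟩
  | loop_done _ hr =>
    cases h' with
    | loop_done => exact ⟨rfl, rfl⟩
    | loop_step hr' _ _ => exact absurd hr hr'
  | loop_step hr _ _ ih₁ ih₂ =>
    cases h' with
    | loop_done _ hr' => exact absurd hr' hr
    | loop_step _ k₁ k₂ =>
      obtain ⟨rfl, rfl⟩ := ih₁ k₁
      obtain ⟨rfl, rfl⟩ := ih₂ k₂
      exact ⟨rfl, rfl⟩

end RAM

/-- The input of a machine that is given an `(s, k)`-puzzle whose rows are listed, in an arbitrary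
order, as `e 0, …, e (s - 1)`: register `0` holds `s`, register `1` holds `k`, and the memory
holds the `s × k` table of symbols row by row, each symbol being written as the number `1`, `2`
or `3`. All other registers and memory cells are `0`. -/
def Puzzle.input {s k : ℕ} (P : Puzzle s k) (e : Fin s ≃ P.rows) : RAM.State where
  reg n := if n = 0 then s else if n = 1 then k else 0
  mem n := if h : n < s * k then
      ((e ⟨n / k, Nat.div_lt_of_lt_mul (by rwa [Nat.mul_comm] at h)⟩).1
        ⟨n % k, Nat.mod_lt _ (Nat.pos_of_mul_pos_left (Nat.zero_lt_of_lt h))⟩ : ℕ) + 1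
    else 0

/-!
Simplification is monotone: a set that induces a simplification of `H` via `R_f` also induces one
of every 3D graph contained in `H`. Hence a 3D graph which no simplification changes survives
inside all simplifications of the 3D graphs containing it (`Stuck.subset_of_simplifiesTo`), and
whether `H` simplifies to the trivial matching can be read off from any stuck outcome of greedy
simplification (`simplifiesTo_trivialMatching_iff`).

For greedy simplification it suffices to try the sets `S` of all vertices reachable from a given
vertex along `R_f`. They always induce a simplification; and if none of them cuts an edge, then
each edge of each `R_f` lies on a directed cycle, so that no inducing set cuts an edge
(`stuck_of_deleteCut_reachSet`). A pass through all `f` and all vertices either deletes one of the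
at most `s ^ 3` edges or finds the 3D graph stuck, so `s ^ 3` passes suffice. A reachable set is
found in `s` rounds of propagating marks.

The algorithm is written as a command `decideSimplifiable` in a language of bounded loops, all of
which have `s` or `k` iterations. Commands have a total semantics `Cmd.exec`, and they compile to
random access programs whose running time is bounded by a polynomial that can be computed from the
command (`Cmd.run_compile`). What the commands compute is shown by loop invariants
(`Cmd.exec_forTo`, `Cmd.exec_forTriple`) that speak about the set of indices already treated.
-/

/-! ### Simplification and reachability -/

namespace Graph3D

variable {U : Type*}

/-- No simplification changes the 3D graph `K`. -/
def Stuck (K : Graph3D U) : Prop :=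
  ∀ (f : Fin 3) (S : Set U), (K.proj f).Induces S → K.deleteCut f S = K

/-- The vertices that can be reached from `v` along the edges of the projection `R_f`. -/
def reachSet (H : Graph3D U) (f : Fin 3) (v : U) : Set U :=
  {u | Relation.ReflTransGen (fun x y => (x, y) ∈ H.proj f) v u}

theorem mem_deleteCut {H : Graph3D U} {f : Fin 3} {S : Set U} {x : U × U × U} :
    x ∈ H.deleteCut f S ↔ x ∈ H ∧ ((dropCoord f x).1 ∈ S ↔ (dropCoord f x).2 ∈ S) := by
  simp only [deleteCut, Graph2D.outCut, Graph2D.inCut, Set.mem_sdiff, Set.mem_preimage,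
    Set.mem_union, Set.mem_prod, Set.mem_compl_iff]
  tauto

theorem deleteCut_subset (H : Graph3D U) (f : Fin 3) (S : Set U) : H.deleteCut f S ⊆ H :=
  Set.sdiff_subset

theorem SimplifiesTo.subset {H H' : Graph3D U} (h : H.SimplifiesTo H') : H' ⊆ H := by
  induction h with
  | refl => exact subset_rfl
  | tail _ hs ih =>
    obtain ⟨f, S, -, rfl⟩ := hs
    exact (deleteCut_subset _ f S).trans ih

/-- Simplification is monotone: a set inducing a simplification of `H` also induces one of each
`K ⊆ H`. Hence a stuck 3D graph survives all simplifications of the 3D graphs containing it. -/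
theorem Stuck.subset_of_simplifiesTo {K H H' : Graph3D U} (hK : K.Stuck) (hKH : K ⊆ H)
    (h : H.SimplifiesTo H') : K ⊆ H' := by
  induction h with
  | refl => exact hKH
  | tail _ hs ih =>
    obtain ⟨f, S, hS, rfl⟩ := hs
    have hsub := Set.image_mono (f := dropCoord f) ih
    have hKS := hK f S (hS.imp
      (fun h0 => Set.subset_eq_empty (Set.inter_subset_inter_right _ hsub) h0)
      (fun h0 => Set.subset_eq_empty (Set.inter_subset_inter_right _ hsub) h0))
    intro x hx
    rw [← hKS] at hx
    exact mem_deleteCut.2 ⟨ih (deleteCut_subset _ f S hx), (mem_deleteCut.1 hx).2⟩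

theorem stuck_trivialMatching : (trivialMatching U).Stuck := by
  intro f S _
  refine (deleteCut_subset _ f S).antisymm ?_
  rintro _ ⟨u, rfl⟩
  refine mem_deleteCut.2 ⟨⟨u, rfl⟩, ?_⟩
  fin_cases f <;> rfl

theorem mem_proj_dropCoord {H : Graph3D U} {x : U × U × U} (hx : x ∈ H) (f : Fin 3) :
    ((dropCoord f x).1, (dropCoord f x).2) ∈ H.proj f := ⟨x, hx, rfl⟩

theorem mem_reachSet_self (H : Graph3D U) (f : Fin 3) (v : U) : v ∈ H.reachSet f v :=
  Relation.ReflTransGen.refl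

theorem reachSet_closed {H : Graph3D U} {f : Fin 3} {v : U} {x : U × U × U} (hx : x ∈ H)
    (h : (dropCoord f x).1 ∈ H.reachSet f v) : (dropCoord f x).2 ∈ H.reachSet f v :=
  Relation.ReflTransGen.tail h (mem_proj_dropCoord hx f)

theorem reachSet_subset {H : Graph3D U} {f : Fin 3} {v : U} {S : Set U} (hv : v ∈ S)
    (hS : ∀ x ∈ H, (dropCoord f x).1 ∈ S → (dropCoord f x).2 ∈ S) : H.reachSet f v ⊆ S := by
  intro u hu
  induction hu with
  | refl => exact hv
  | tail _ he ih =>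
    obtain ⟨x, hx, h⟩ := he
    have := hS x hx
    rw [h] at this
    exact this ih

/-- The set of vertices reachable from a given one induces a simplification. -/
theorem simplifies_deleteCut_reachSet (H : Graph3D U) (f : Fin 3) (v : U) :
    H.SimplifiesTo (H.deleteCut f (H.reachSet f v)) := by
  refine .single ⟨f, _, .inl (Set.eq_empty_of_forall_notMem ?_), rfl⟩
  rintro ⟨a, b⟩ ⟨⟨ha, hb⟩, x, hx, h⟩
  have := reachSet_closed (v := v) hx (f := f)
  rw [h] at this
  exact hb (this ha)

/-- Reachable sets suffice: if none of them cuts an edge, then each edge of `R_f` lies on a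
cycle, and cycles are not cut by any set which induces a simplification. -/
theorem stuck_of_deleteCut_reachSet {H : Graph3D U}
    (h : ∀ f v, H.deleteCut f (H.reachSet f v) = H) : H.Stuck := by
  intro f S hS
  refine (deleteCut_subset _ f S).antisymm fun x hx => mem_deleteCut.2 ⟨hx, ?_⟩
  have hback : (dropCoord f x).1 ∈ H.reachSet f (dropCoord f x).2 := by
    have hx' := hx
    rw [← h f (dropCoord f x).2] at hx'
    exact (mem_deleteCut.1 hx').2.2 (mem_reachSet_self _ _ _)
  rcases hS with hS | hS
  · have hcl : ∀ y ∈ H, (dropCoord f y).1 ∈ S → (dropCoord f y).2 ∈ S := by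
      intro y hy h1
      by_contra h2
      exact (hS.subset ⟨⟨h1, h2⟩, mem_proj_dropCoord hy f⟩ : _ ∈ (∅ : Set _))
    exact ⟨hcl x hx, fun h2 => reachSet_subset h2 hcl hback⟩
  · have hcl : ∀ y ∈ H, (dropCoord f y).1 ∈ Sᶜ → (dropCoord f y).2 ∈ Sᶜ := by
      intro y hy h1 h2
      exact (hS.subset ⟨⟨h1, h2⟩, mem_proj_dropCoord hy f⟩ : _ ∈ (∅ : Set _))
    exact not_iff_not.1 ⟨hcl x hx, fun h2 => reachSet_subset h2 hcl hback⟩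

/-- Simplification is confluent: the outcome can be read off from any stuck 3D graph that is
reached. -/
theorem simplifiesTo_trivialMatching_iff {H K : Graph3D U} (hH : trivialMatching U ⊆ H)
    (h : H.SimplifiesTo K) (hK : K.Stuck) :
    H.SimplifiesTo (trivialMatching U) ↔ K ⊆ trivialMatching U := by
  constructor
  · exact fun hT => hK.subset_of_simplifiesTo h.subset hT
  · intro hT
    rwa [← hT.antisymm (stuck_trivialMatching.subset_of_simplifiesTo hH h)]

end Graph3D

/-! ### A language of bounded loops -/

namespace RAM

@[simp] theorem State.setReg_reg (σ : State) (r n r' : ℕ) :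
    (σ.setReg r n).reg r' = if r' = r then n else σ.reg r' := by
  simp [State.setReg, Function.update_apply]

@[simp] theorem State.setReg_mem (σ : State) (r n : ℕ) : (σ.setReg r n).mem = σ.mem := rfl

@[simp] theorem State.setMem_reg (σ : State) (a n : ℕ) : (σ.setMem a n).reg = σ.reg := rfl

@[simp] theorem State.setMem_mem (σ : State) (a n : ℕ) :
    (σ.setMem a n).mem = Function.update σ.mem a n := rfl

theorem State.setReg_setReg (σ : State) (r n n' : ℕ) :
    (σ.setReg r n).setReg r n' = σ.setReg r n' := by
  simp [State.setReg]

/-- Commands: random access programs whose only loops are `for` loops with `reg 0` or `reg 1`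
iterations. In the command `forTo i n c` the index register `i` counts down from `reg n - 1`
to `0`. -/
inductive Cmd where
  | skip : Cmd
  | const (r n : ℕ) : Cmd
  | add (r a b : ℕ) : Cmd
  | sub (r a b : ℕ) : Cmd
  | load (r a : ℕ) : Cmd
  | store (a b : ℕ) : Cmd
  | seq (p q : Cmd) : Cmd
  | branch (r : ℕ) (p q : Cmd) : Cmd
  | forTo (i : ℕ) (n : Fin 2) (c : Cmd) : Cmd

namespace Cmd

/-- Run the state transformer `f` with the index register `i` set to `j - 1`, …, `0`. -/
def iter (f : State → State) (i : ℕ) : ℕ → State → State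
  | 0, σ => σ
  | j + 1, σ => iter f i j (f (σ.setReg i j))

/-- The final state of a command; commands always halt. -/
def exec : Cmd → State → State
  | skip, σ => σ
  | const r n, σ => σ.setReg r n
  | add r a b, σ => σ.setReg r (σ.reg a + σ.reg b)
  | sub r a b, σ => σ.setReg r (σ.reg a - σ.reg b)
  | load r a, σ => σ.setReg r (σ.mem (σ.reg a))
  | store a b, σ => σ.setMem (σ.reg a) (σ.reg b)
  | seq p q, σ => q.exec (p.exec σ)
  | branch r p q, σ => if σ.reg r ≠ 0 then p.exec σ else q.exec σ
  | forTo i n c, σ => iter c.exec i (σ.reg n) (σ.setReg i (σ.reg n))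

theorem exec_seq (p q : Cmd) (σ : State) : (seq p q).exec σ = q.exec (p.exec σ) := rfl

/-- The program that a command stands for. Loops decrement their index by subtracting
register `2`, which has to hold the number `1`. -/
def compile : Cmd → Program
  | skip => .skip
  | const r n => .const r n
  | add r a b => .add r a b
  | sub r a b => .sub r a b
  | load r a => .load r a
  | store a b => .store a b
  | seq p q => .seq p.compile q.compile
  | branch r p q => .branch r p.compile q.compile
  | forTo i n c =>
    .seq (.const i 0) (.seq (.add i n i) (.loop i (.seq (.sub i i 2) c.compile)))

/-- A bound on the running time, as a polynomial in the contents of the registers `0` and `1`. -/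
noncomputable def cost : Cmd → MvPolynomial (Fin 2) ℕ
  | seq p q => p.cost + q.cost
  | branch _ p q => 1 + p.cost + q.cost
  | forTo _ n c => MvPolynomial.X n * (c.cost + 2) + 3
  | _ => 1

/-- The command contains no assignment to the register `r`. -/
def keeps (r : ℕ) : Cmd → Bool
  | skip | store _ _ => true
  | const r' _ | add r' _ _ | sub r' _ _ | load r' _ => r' != r
  | seq p q | branch _ p q => p.keeps r && q.keeps r
  | forTo i _ c => i != r && c.keeps r

/-- No loop body assigns to its index register. -/
def loopsOk : Cmd → Bool
  | seq p q | branch _ p q => p.loopsOk && q.loopsOk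
  | forTo i _ c => c.keeps i && c.loopsOk
  | _ => true

theorem iter_reg {f : State → State} {i r : ℕ} (hr : r ≠ i)
    (hf : ∀ σ : State, (f σ).reg r = σ.reg r) (j : ℕ) (σ : State) :
    (iter f i j σ).reg r = σ.reg r := by
  induction j generalizing σ with
  | zero => rfl
  | succ j ih => simp [iter, ih, hf, hr]

theorem exec_reg {c : Cmd} {r : ℕ} (h : c.keeps r = true) (σ : State) :
    (c.exec σ).reg r = σ.reg r := by
  induction c generalizing σ with
  | skip | store => simp [exec]
  | const | add | sub | load =>
    simp only [keeps, bne_iff_ne, ne_eq] at h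
    simp [exec, Ne.symm h]
  | seq p q ihp ihq =>
    simp only [keeps, Bool.and_eq_true] at h
    rw [exec, ihq h.2, ihp h.1]
  | branch a p q ihp ihq =>
    simp only [keeps, Bool.and_eq_true] at h
    rw [exec]
    split
    · exact ihp h.1 σ
    · exact ihq h.2 σ
  | forTo i n c ih =>
    simp only [keeps, Bool.and_eq_true, bne_iff_ne, ne_eq] at h
    have hr : r ≠ i := Ne.symm h.1
    rw [exec, iter_reg hr (fun σ => ih h.2 σ)]
    simp [hr]

/-- The loop in a compiled `forTo` takes at most `j * (B + 2) + 1` steps from index `j`, when each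
run of the body takes at most `B` steps. The invariant `A` keeps the bound `B` valid throughout. -/
theorem run_loop {c : Cmd} {i B : ℕ} (hi : c.keeps i = true)
    (h2 : i ≠ 2) (k2 : c.keeps 2 = true) (A : State → Prop)
    (hA : ∀ σ j, A σ → A (c.exec (σ.setReg i j)))
    (hc : ∀ σ j, A σ → σ.reg 2 = 1 → ∃ t, t ≤ B ∧
      Run c.compile (σ.setReg i j) t (c.exec (σ.setReg i j)))
    (j : ℕ) (σ : State) (hσ : A σ) (h1 : σ.reg 2 = 1) (hj : σ.reg i = j) :
    ∃ t, t ≤ j * (B + 2) + 1 ∧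
      Run (.loop i (.seq (.sub i i 2) c.compile)) σ t (iter c.exec i j σ) := by
  induction j generalizing σ with
  | zero => exact ⟨1, by simp, .loop_done _ hj⟩
  | succ j ih =>
    obtain ⟨t, ht, hrun⟩ := hc σ j hσ h1
    obtain ⟨t', ht', hrun'⟩ := ih (c.exec (σ.setReg i j)) (hA σ j hσ)
      (by rw [exec_reg k2]; simp [h1, Ne.symm h2]) (by rw [exec_reg hi]; simp)
    have hsub := Run.sub i i 2 σ
    rw [hj, h1, Nat.add_sub_cancel] at hsub
    refine ⟨1 + (1 + t) + t', ?_, .loop_step (by omega) (.seq hsub hrun) hrun'⟩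
    rw [Nat.add_mul]
    omega

/-- The program of a command computes the final state of the command in polynomial time: the
numbers of iterations are the contents of register `0` or `1`, which the command does not
change. -/
theorem run_compile {c : Cmd} (hok : c.loopsOk = true) (k0 : c.keeps 0 = true)
    (k1 : c.keeps 1 = true) (k2 : c.keeps 2 = true) (σ : State) (h1 : σ.reg 2 = 1) :
    ∃ t, t ≤ MvPolynomial.eval ![σ.reg 0, σ.reg 1] c.cost ∧
      Run c.compile σ t (c.exec σ) := by
  induction c generalizing σ with
  | skip => exact ⟨1, by simp [cost], .skip σ⟩
  | const r n => exact ⟨1, by simp [cost], .const r n σ⟩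
  | add r a b => exact ⟨1, by simp [cost], .add r a b σ⟩
  | sub r a b => exact ⟨1, by simp [cost], .sub r a b σ⟩
  | load r a => exact ⟨1, by simp [cost], .load r a σ⟩
  | store a b => exact ⟨1, by simp [cost], .store a b σ⟩
  | seq p q ihp ihq =>
    simp only [keeps, loopsOk, Bool.and_eq_true] at *
    obtain ⟨t, ht, hp⟩ := ihp hok.1 k0.1 k1.1 k2.1 σ h1
    obtain ⟨t', ht', hq⟩ := ihq hok.2 k0.2 k1.2 k2.2 (p.exec σ) (by rw [exec_reg k2.1, h1])
    rw [exec_reg k0.1, exec_reg k1.1] at ht'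
    exact ⟨t + t', by simpa [cost] using Nat.add_le_add ht ht', .seq hp hq⟩
  | branch r p q ihp ihq =>
    simp only [keeps, loopsOk, Bool.and_eq_true] at *
    rw [exec]
    split
    · obtain ⟨t, ht, hp⟩ := ihp hok.1 k0.1 k1.1 k2.1 σ h1
      exact ⟨1 + t, by simp [cost]; omega, .branch_true _ ‹_› hp⟩
    · obtain ⟨t, ht, hq⟩ := ihq hok.2 k0.2 k1.2 k2.2 σ h1
      exact ⟨1 + t, by simp [cost]; omega, .branch_false _ (not_not.1 ‹_›) hq⟩
  | forTo i n c ih =>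
    simp only [keeps, loopsOk, Bool.and_eq_true, bne_iff_ne, ne_eq] at *
    obtain ⟨t, ht, hl⟩ := run_loop (c := c) (i := i)
      (B := MvPolynomial.eval ![σ.reg 0, σ.reg 1] c.cost) hok.1 k2.1 k2.2
      (fun τ => τ.reg 0 = σ.reg 0 ∧ τ.reg 1 = σ.reg 1)
      (fun τ j hτ => by
        rw [exec_reg k0.2, exec_reg k1.2]
        simpa [Ne.symm k0.1, Ne.symm k1.1] using hτ)
      (fun τ j hτ hτ2 => by
        have := ih hok.2 k0.2 k1.2 k2.2 (τ.setReg i j) (by simp [hτ2, Ne.symm k2.1])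
        simpa [Ne.symm k0.1, Ne.symm k1.1, hτ] using this)
      (σ.reg n) (σ.setReg i (σ.reg n)) (by simp [Ne.symm k0.1, Ne.symm k1.1])
      (by simp [h1, Ne.symm k2.1]) (by simp)
    have hn : (n : ℕ) ≠ i := by
      rintro rfl
      fin_cases n
      · exact k0.1 rfl
      · exact k1.1 rfl
    have hv : ![σ.reg 0, σ.reg 1] n = σ.reg n := by fin_cases n <;> rfl
    refine ⟨1 + (1 + t), ?_, .seq (.const i 0 σ) (.seq (.add i n i _) ?_)⟩
    · simp only [cost, map_add, map_mul, MvPolynomial.eval_X, map_ofNat, hv]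
      omega
    · simpa [State.setReg_setReg, hn, exec] using hl

/-! ### Invariants of loops -/

/-- The `for` rule. The invariant depends on the set of indices treated so far (labelled by a
type `ι`), on the memory and on one accumulator register; all registers not assigned to in the
body keep their values. -/
theorem exec_forTo {ι : Type*} {N : ℕ} (ix : ι ≃ Fin N) {i : ℕ} {n : Fin 2} {c : Cmd} {acc : ℕ}
    {σ : State} (hn : σ.reg n = N) (hacc : acc ≠ i) (Inv : Set ι → (ℕ → ℕ) → ℕ → Prop)
    (h0 : Inv ∅ σ.mem (σ.reg acc))
    (step : ∀ (D : Set ι) (x : ι) (τ : State), x ∉ D → Inv D τ.mem (τ.reg acc) →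
      τ.reg i = ix x → (∀ r, r ≠ i → c.keeps r = true → τ.reg r = σ.reg r) →
      Inv (insert x D) (c.exec τ).mem ((c.exec τ).reg acc)) :
    Inv Set.univ ((forTo i n c).exec σ).mem (((forTo i n c).exec σ).reg acc) := by
  have key : ∀ (j : ℕ) (τ : State), j ≤ N → Inv {x | j ≤ ix x} τ.mem (τ.reg acc) →
      (∀ r, r ≠ i → c.keeps r = true → τ.reg r = σ.reg r) →
      Inv Set.univ (iter c.exec i j τ).mem ((iter c.exec i j τ).reg acc) := by
    intro j
    induction j with
    | zero =>
      intro τ _ h _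
      simpa [iter] using h
    | succ j ih =>
      intro τ hj h hk
      -- The index counts down, so the indices treated so far are those which are at least `j`.
      have hD : {x : ι | j ≤ (ix x : ℕ)} =
          insert (ix.symm ⟨j, hj⟩) {x : ι | j + 1 ≤ (ix x : ℕ)} := by
        ext x
        have : x = ix.symm ⟨j, hj⟩ ↔ (ix x : ℕ) = j := by
          rw [Equiv.eq_symm_apply, Fin.ext_iff]
        simp only [Set.mem_insert_iff, Set.mem_ofPred_eq, this]
        omega
      have hk' : ∀ r, r ≠ i → c.keeps r = true → (τ.setReg i j).reg r = σ.reg r := by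
        intro r hr hcr
        simp [hr, hk r hr hcr]
      refine ih (c.exec (τ.setReg i j)) (by omega) ?_ ?_
      · rw [hD]
        exact step _ _ (τ.setReg i j) (by simp) (by simpa [hacc] using h) (by simp) hk'
      · intro r hr hcr
        rw [exec_reg hcr, hk' r hr hcr]
  rw [exec, hn]
  refine key N _ le_rfl ?_ (fun r hr _ => by simp [hr])
  have : {x : ι | N ≤ (ix x : ℕ)} = ∅ := by
    ext x
    simp
  rw [this]
  simpa [hacc] using h0

/-- Three nested loops with `reg 0` iterations each. -/
def forTriple (i₁ i₂ i₃ : ℕ) (c : Cmd) : Cmd := forTo i₁ 0 (forTo i₂ 0 (forTo i₃ 0 c))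

/-- The `for` rule for three nested loops. -/
theorem exec_forTriple {U : Type*} {s : ℕ} (ix : U ≃ Fin s) {i₁ i₂ i₃ : ℕ} {c : Cmd} {acc : ℕ}
    {σ : State} (hs : σ.reg 0 = s) (h₁ : acc ≠ i₁) (h₂ : acc ≠ i₂) (h₃ : acc ≠ i₃)
    (h₁₂ : i₁ ≠ i₂) (h₁₃ : i₁ ≠ i₃) (h₂₃ : i₂ ≠ i₃)
    (hc₁ : c.keeps i₁ = true) (hc₂ : c.keeps i₂ = true) (hc₀ : c.keeps 0 = true)
    (h0₁ : i₁ ≠ 0) (h0₂ : i₂ ≠ 0) (h0₃ : i₃ ≠ 0)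
    (Inv : Set (U × U × U) → (ℕ → ℕ) → ℕ → Prop)
    (h0 : Inv ∅ σ.mem (σ.reg acc))
    (step : ∀ (D : Set (U × U × U)) (x : U × U × U) (τ : State), x ∉ D →
      Inv D τ.mem (τ.reg acc) →
      τ.reg i₁ = ix x.1 → τ.reg i₂ = ix x.2.1 → τ.reg i₃ = ix x.2.2 →
      (∀ r, r ≠ i₁ → r ≠ i₂ → r ≠ i₃ → c.keeps r = true → τ.reg r = σ.reg r) →
      Inv (insert x D) (c.exec τ).mem ((c.exec τ).reg acc)) :
    Inv Set.univ ((forTriple i₁ i₂ i₃ c).exec σ).mem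
      (((forTriple i₁ i₂ i₃ c).exec σ).reg acc) := by
  have main := exec_forTo ix (i := i₁) (n := 0) (c := forTo i₂ 0 (forTo i₃ 0 c)) (acc := acc)
    hs h₁ (fun D m v => Inv {x | x.1 ∈ D} m v) (by simpa using h0) ?_
  · simpa [forTriple] using main
  intro D a τ ha hInv hτ₁ hτk
  have hτ0 : τ.reg 0 = s := by
    rw [hτk 0 (Ne.symm h0₁) (by simp [keeps, hc₀, h0₂, h0₃]), hs]
  have main := exec_forTo ix (i := i₂) (n := 0) (c := forTo i₃ 0 c) (acc := acc) hτ0 h₂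
    (fun E m v => Inv {x | x.1 ∈ D ∨ x.1 = a ∧ x.2.1 ∈ E} m v) (by simpa using hInv) ?_
  · convert main using 2
    ext x
    simp [or_comm]
  intro E b τ' hb hInv' hτ₂ hτk'
  have hτ0' : τ'.reg 0 = s := by
    rw [hτk' 0 (Ne.symm h0₂) (by simp [keeps, hc₀, h0₃]), hτ0]
  have main := exec_forTo ix (i := i₃) (n := 0) (c := c) (acc := acc) hτ0' h₃
    (fun F m v => Inv {x | x.1 ∈ D ∨ x.1 = a ∧ (x.2.1 ∈ E ∨ x.2.1 = b ∧ x.2.2 ∈ F)} m v)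
    (by simpa using hInv') ?_
  · convert main using 2
    ext x
    simp [or_comm]
  intro F d ρ hd hInv'' hτ₃ hτk''
  have hρ₂ : ρ.reg i₂ = ix b := by rw [hτk'' i₂ h₂₃ hc₂, hτ₂]
  have hρ₁ : ρ.reg i₁ = ix a := by
    rw [hτk'' i₁ h₁₃ hc₁, hτk' i₁ h₁₂ (by simp [keeps, hc₁, Ne.symm h₁₃]), hτ₁]
  have := step _ (a, b, d) ρ (by simp [ha, hb, hd]) hInv'' hρ₁ hρ₂ hτ₃
    (fun r hr₁ hr₂ hr₃ hr => by
      rw [hτk'' r hr₃ hr, hτk' r hr₂ (by simp [keeps, hr, Ne.symm hr₃]),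
        hτk r hr₁ (by simp [keeps, hr, Ne.symm hr₃, Ne.symm hr₂])])
  convert this using 2
  ext ⟨x, y, z⟩
  simp only [Set.mem_ofPred_eq, Set.mem_insert_iff, Prod.mk.injEq]
  tauto

end Cmd

end RAM

/-! ### The algorithm -/

namespace RAM

open Graph3D

local infixr:60 " ;; " => Cmd.seq

namespace Cmd

/-- `r := reg a * reg n`, by repeated addition -/
def mul (r a : ℕ) (n : Fin 2) : Cmd := const r 0 ;; forTo 3 n (add r r a)

/-- Register `8` receives the address of the table entry of the triple held by the registers
`10`, `11`, `12`; register `6` holds the address of the table. -/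
def addr : Cmd := mul 7 10 0 ;; add 7 7 11 ;; mul 8 7 0 ;; add 8 8 12 ;; add 8 8 6

/-- Increment register `9` if the symbol `c` stands in the row `reg row` and the column
`reg 13`. -/
def countSymbol (row c : ℕ) : Cmd :=
  mul 7 row 1 ;; add 7 7 13 ;; load 7 7 ;; const 8 c ;; sub 16 7 8 ;; sub 8 8 7 ;;
    add 8 8 16 ;; branch 8 skip (add 9 9 2)

/-- Set register `4` to `0` if the column `reg 13` shows that the triple of rows held by the
registers `10`, `11`, `12` is no edge of the 3D graph. -/
def testColumn : Cmd :=
  const 9 0 ;; countSymbol 10 1 ;; countSymbol 11 2 ;; countSymbol 12 3 ;;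
    const 8 2 ;; sub 16 9 8 ;; sub 8 8 9 ;; add 8 8 16 ;; branch 8 skip (const 4 0)

/-- Write the table of the 3D graph of the puzzle, testing all columns for each triple. -/
def build : Cmd :=
  forTriple 10 11 12 (const 4 1 ;; forTo 13 1 testColumn ;; addr ;; store 8 4)

/-- The register holding the first coordinate of `dropCoord f` of the current triple. -/
def src : Fin 3 → ℕ
  | 0 => 11
  | _ => 10

/-- The register holding the second coordinate of `dropCoord f` of the current triple. -/
def tgt : Fin 3 → ℕ
  | 2 => 11
  | _ => 12

/-- Mark the vertex `reg 14` and no other vertex. Register `5` holds the address of the table of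
marks. -/
def initMarks : Cmd := forTo 13 0 (add 9 5 13 ;; const 7 0 ;; store 9 7) ;; add 9 5 14 ;; store 9 2

/-- If the current triple is an edge, mark the second vertex of its projection provided that the
first one is marked. -/
def propagate (f : Fin 3) : Cmd :=
  addr ;; load 8 8 ;;
    branch 8 (add 9 5 (src f) ;; load 9 9 ;; branch 9 (add 9 5 (tgt f) ;; store 9 2) skip) skip

/-- Delete the current triple if exactly one of the two vertices of its projection is marked. -/
def cutTriple (f : Fin 3) : Cmd :=
  addr ;; add 9 5 (src f) ;; load 9 9 ;; add 7 5 (tgt f) ;; load 7 7 ;;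
    branch 9 (branch 7 skip (const 9 0 ;; store 8 9)) (branch 7 (const 9 0 ;; store 8 9) skip)

/-- Simplify via `R_f` by means of the set of vertices reachable from the vertex `reg 14`. -/
def cutReachable (f : Fin 3) : Cmd :=
  initMarks ;; forTo 15 0 (forTriple 10 11 12 (propagate f)) ;;
    forTriple 10 11 12 (cutTriple f)

/-- Simplify once by means of each reachable set. -/
def pass : Cmd := forTo 14 0 (cutReachable 0 ;; cutReachable 1 ;; cutReachable 2)

/-- Set register `4` to `0` if the current triple is an edge off the diagonal. -/
def testDiagonal : Cmd :=
  addr ;; load 8 8 ;;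
    branch 8 (sub 7 10 11 ;; sub 9 11 10 ;; add 7 7 9 ;; sub 9 11 12 ;; add 7 7 9 ;;
      sub 9 12 11 ;; add 7 7 9 ;; branch 7 (const 4 0) skip) skip

/-- The algorithm, with its answer in register `4`. The puzzle occupies the first `s * k` memory
cells; the next `s` cells are the table of marks and the `s ^ 3` cells after them the table of
edges. The loop over all triples in the registers `20`, `21`, `22` just repeats the pass `s ^ 3`
times. -/
def decideSimplifiable : Cmd :=
  mul 5 0 1 ;; add 6 5 0 ;; build ;; forTriple 20 21 22 pass ;; const 4 1 ;;
    forTriple 10 11 12 testDiagonal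

theorem exec_mul {r a : ℕ} {n : Fin 2} {σ : State} (hr : r ≠ 3) (har : a ≠ r) (ha : a ≠ 3)
    (hn : (n : ℕ) ≠ r) :
    (mul r a n).exec σ = (σ.setReg r (σ.reg a * σ.reg n)).setReg 3 0 := by
  -- If there is no iteration, then the index register already holds `0`.
  have key : ∀ (j : ℕ) (τ : State), (j = 0 → τ.reg 3 = 0) →
      iter (add r r a).exec 3 j τ =
        (τ.setReg r (τ.reg r + τ.reg a * j)).setReg 3 0 := by
    intro j
    induction j with
    | zero =>
      rintro ⟨reg, mem⟩ h
      simp only [iter, State.setReg, State.mk.injEq, and_true]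
      funext x
      by_cases h3 : x = 3 <;> by_cases hx : x = r <;> simp_all
    | succ j ih =>
      rintro ⟨reg, mem⟩ -
      by_cases hj : j = 0
      · subst hj
        simp only [iter, exec, State.setReg, State.mk.injEq, and_true]
        funext x
        by_cases h3 : x = 3 <;> by_cases hx : x = r <;> simp_all
      · rw [iter, ih _ (by simp [hj])]
        simp only [exec, State.setReg, State.mk.injEq, and_true]
        funext x
        by_cases h3 : x = 3 <;> by_cases hx : x = r <;> simp_all
        ring
  rw [mul, exec, exec, exec, key _ _ (by simp)]
  obtain ⟨reg, mem⟩ := σ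
  simp only [State.setReg, State.mk.injEq, and_true]
  funext x
  by_cases h3 : x = 3 <;> by_cases hx : x = r <;> simp_all

end Cmd

/-! ### Tables of edges and marks -/

section Tables

variable {U : Type*} {s : ℕ} (ix : U ≃ Fin s) (B : ℕ)

/-- The position of a triple in the lexicographic order, where the vertices are numbered
by `ix`. -/
def code (x : U × U × U) : ℕ := ((ix x.1 : ℕ) * s + ix x.2.1) * s + ix x.2.2

/-- The 3D graph in the memory: its table of edges starts at address `B + s`. -/
def memGraph (m : ℕ → ℕ) : Graph3D U := {x | m (B + s + code ix x) ≠ 0}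

/-- The set of marked vertices: the table of marks starts at address `B`. -/
def memSet (m : ℕ → ℕ) : Set U := {u | m (B + ix u) ≠ 0}

theorem code_injective : Function.Injective (code ix) := by
  have aux : ∀ {a a' b b' : ℕ}, b < s → b' < s → a * s + b = a' * s + b' → a = a' ∧ b = b' := by
    intro a a' b b' hb hb' h
    have h1 := congrArg (· / s) h
    have hs : 0 < s := by omega
    simp only [Nat.mul_comm _ s, Nat.mul_add_div hs, Nat.div_eq_of_lt hb, Nat.div_eq_of_lt hb',
      Nat.add_zero] at h1
    subst h1
    exact ⟨rfl, by omega⟩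
  rintro ⟨a, b, c⟩ ⟨a', b', c'⟩ h
  obtain ⟨h1, h2⟩ := aux (ix c).2 (ix c').2 h
  obtain ⟨h3, h4⟩ := aux (ix b).2 (ix b').2 h1
  simp only at h3
  rw [ix.injective (Fin.ext h2), ix.injective (Fin.ext h3), ix.injective (Fin.ext h4)]

variable {ix B} {m : ℕ → ℕ}

theorem memGraph_congr {m' : ℕ → ℕ} (h : ∀ n, B + s ≤ n → m' n = m n) :
    memGraph ix B m' = memGraph ix B m := by
  ext x
  simp [memGraph, h (B + s + code ix x) (by omega)]

theorem mem_memGraph_update {x y : U × U × U} {n : ℕ} :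
    y ∈ memGraph ix B (Function.update m (B + s + code ix x) n) ↔
      (y = x ∧ n ≠ 0) ∨ (y ≠ x ∧ y ∈ memGraph ix B m) := by
  by_cases h : y = x
  · simp [memGraph, h]
  · simp [memGraph, h, Function.update_apply, (code_injective ix).eq_iff]

theorem memSet_update_code {x : U × U × U} {n : ℕ} :
    memSet ix B (Function.update m (B + s + code ix x) n) = memSet ix B m := by
  ext u
  have : B + (ix u : ℕ) ≠ B + s + code ix x := by have := (ix u).2; omega
  simp [memSet, Function.update_apply, this]

theorem memGraph_update_mark {u : U} {n : ℕ} :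
    memGraph ix B (Function.update m (B + ix u) n) = memGraph ix B m :=
  memGraph_congr fun a ha => Function.update_of_ne (by have := (ix u).2; omega) _ _

theorem mem_memSet_update {u w : U} {n : ℕ} :
    w ∈ memSet ix B (Function.update m (B + ix u) n) ↔
      (w = u ∧ n ≠ 0) ∨ (w ≠ u ∧ w ∈ memSet ix B m) := by
  by_cases h : w = u
  · simp [memSet, h]
  · simp [memSet, h, Function.update_apply, Fin.val_inj]

end Tables

/-! ### Simplification by reachable sets -/

namespace Cmd

variable {U : Type*} {s : ℕ} {ix : U ≃ Fin s} {B : ℕ}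

/-- The state holds the number `s` of vertices, the constant `1` and the addresses of the tables. -/
structure Ready (s B : ℕ) (σ : State) : Prop where
  size : σ.reg 0 = s
  one : σ.reg 2 = 1
  marks : σ.reg 5 = B
  table : σ.reg 6 = B + s

/-- The registers `10`, `11`, `12` hold the triple `x`. -/
structure Holds (ix : U ≃ Fin s) (x : U × U × U) (τ : State) : Prop where
  fst : τ.reg 10 = ix x.1
  snd : τ.reg 11 = ix x.2.1
  trd : τ.reg 12 = ix x.2.2

theorem Ready.of_eq {σ τ : State} (h : Ready s B σ)
    (hτ : ∀ r ∈ [0, 2, 5, 6], τ.reg r = σ.reg r) : Ready s B τ :=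
  ⟨by rw [hτ 0 (by simp), h.size], by rw [hτ 2 (by simp), h.one],
    by rw [hτ 5 (by simp), h.marks], by rw [hτ 6 (by simp), h.table]⟩

theorem Ready.exec {σ : State} (h : Ready s B σ) {c : Cmd}
    (hc : ∀ r ∈ [0, 2, 5, 6], c.keeps r = true) : Ready s B (c.exec σ) :=
  h.of_eq fun r hr => exec_reg (hc r hr) σ

/-- The rule `exec_forTriple` for loops over all triples of vertices. -/
theorem exec_forTriple_holds {c : Cmd} {σ : State} (hσ : Ready s B σ)
    (hc : ∀ r ∈ [0, 2, 5, 6, 10, 11], c.keeps r = true)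
    (Inv : Set (U × U × U) → (ℕ → ℕ) → ℕ → Prop)
    (h0 : Inv ∅ σ.mem (σ.reg 4))
    (step : ∀ (D : Set (U × U × U)) (x : U × U × U) (τ : State), Ready s B τ → Holds ix x τ →
      Inv D τ.mem (τ.reg 4) → (c.keeps 1 = true → τ.reg 1 = σ.reg 1) →
      Inv (insert x D) (c.exec τ).mem ((c.exec τ).reg 4)) :
    Inv Set.univ ((forTriple 10 11 12 c).exec σ).mem
      (((forTriple 10 11 12 c).exec σ).reg 4) := by
  refine exec_forTriple ix hσ.size (by decide) (by decide) (by decide) (by decide) (by decide)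
    (by decide) (hc 10 (by simp)) (hc 11 (by simp)) (hc 0 (by simp)) (by decide) (by decide)
    (by decide) Inv h0 fun D x τ _ hInv h1 h2 h3 hτ => ?_
  refine step D x τ (hσ.of_eq fun r hr => ?_) ⟨h1, h2, h3⟩ hInv
    (hτ 1 (by decide) (by decide) (by decide))
  refine hτ r ?_ ?_ ?_ (hc r (by simp at hr ⊢; tauto)) <;> rintro rfl <;> simp at hr

theorem Holds.src {x : U × U × U} {τ : State} (h : Holds ix x τ) (f : Fin 3) :
    τ.reg (src f) = ix (dropCoord f x).1 := by
  fin_cases f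
  exacts [h.snd, h.fst, h.fst]

theorem Holds.tgt {x : U × U × U} {τ : State} (h : Holds ix x τ) (f : Fin 3) :
    τ.reg (tgt f) = ix (dropCoord f x).2 := by
  fin_cases f
  exacts [h.trd, h.trd, h.snd]

theorem exec_addr_mem (τ : State) : (addr.exec τ).mem = τ.mem := by
  simp [addr, exec, exec_mul]

theorem exec_addr_reg {x : U × U × U} {τ : State} (hτ : Ready s B τ) (h : Holds ix x τ) :
    (addr.exec τ).reg 8 = B + s + code ix x := by
  simp [addr, exec, exec_mul, hτ.size, hτ.table, h.fst, h.snd, h.trd, code]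
  ring

theorem Holds.exec {x : U × U × U} {τ : State} (h : Holds ix x τ) {c : Cmd}
    (hc : ∀ r ∈ [10, 11, 12], c.keeps r = true) : Holds ix x (c.exec τ) :=
  ⟨by rw [exec_reg (hc 10 (by simp)), h.fst], by rw [exec_reg (hc 11 (by simp)), h.snd],
    by rw [exec_reg (hc 12 (by simp)), h.trd]⟩

open Classical in
theorem exec_propagate_mem {x : U × U × U} {τ : State} (hτ : Ready s B τ) (h : Holds ix x τ)
    (f : Fin 3) : ((propagate f).exec τ).mem =
      if x ∈ memGraph ix B τ.mem ∧ (dropCoord f x).1 ∈ memSet ix B τ.mem then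
        Function.update τ.mem (B + ix (dropCoord f x).2) 1 else τ.mem := by
  have hτ' := hτ.exec (c := addr) (by decide)
  have h' := h.exec (c := addr) (by decide)
  have ha := exec_addr_reg hτ h
  have hm := exec_addr_mem τ
  rw [propagate, exec]
  generalize addr.exec τ = τ' at *
  have hs := h'.src f
  have ht := h'.tgt f
  have h8 : Cmd.src f ≠ 8 := by fin_cases f <;> decide
  have h9 : Cmd.tgt f ≠ 8 ∧ Cmd.tgt f ≠ 9 := by fin_cases f <;> decide
  by_cases h1 : x ∈ memGraph ix B τ.mem
  · have h1' : τ.mem (B + s + code ix x) ≠ 0 := h1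
    by_cases h2 : (dropCoord f x).1 ∈ memSet ix B τ.mem
    · have h2' : τ.mem (B + ix (dropCoord f x).1) ≠ 0 := h2
      simp [exec, ha, hm, h1, h2, h1', h2', hs, ht, h8, h9, hτ'.marks, hτ'.one]
    · have h2' : τ.mem (B + ix (dropCoord f x).1) = 0 := not_not.1 h2
      simp [exec, ha, hm, h2, h1', h2', hs, h8, hτ'.marks]
  · have h1' : τ.mem (B + s + code ix x) = 0 := not_not.1 h1
    simp [exec, ha, hm, h1, h1']

open Classical in
theorem exec_cutTriple_mem {x : U × U × U} {τ : State} (hτ : Ready s B τ) (h : Holds ix x τ)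
    (f : Fin 3) : ((cutTriple f).exec τ).mem =
      if (dropCoord f x).1 ∈ memSet ix B τ.mem ↔ (dropCoord f x).2 ∈ memSet ix B τ.mem then
        τ.mem else Function.update τ.mem (B + s + code ix x) 0 := by
  have hτ' := hτ.exec (c := addr) (by decide)
  have h' := h.exec (c := addr) (by decide)
  have ha := exec_addr_reg hτ h
  have hm := exec_addr_mem τ
  rw [cutTriple, exec]
  generalize addr.exec τ = τ' at *
  have hs := h'.src f
  have ht := h'.tgt f
  have h9 : Cmd.tgt f ≠ 9 := by fin_cases f <;> decide
  by_cases h1 : (dropCoord f x).1 ∈ memSet ix B τ.mem <;>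
    by_cases h2 : (dropCoord f x).2 ∈ memSet ix B τ.mem
  · have h1' : τ.mem (B + ix (dropCoord f x).1) ≠ 0 := h1
    have h2' : τ.mem (B + ix (dropCoord f x).2) ≠ 0 := h2
    simp [exec, hm, h1, h2, h1', h2', hs, ht, h9, hτ'.marks]
  · have h1' : τ.mem (B + ix (dropCoord f x).1) ≠ 0 := h1
    have h2' : τ.mem (B + ix (dropCoord f x).2) = 0 := not_not.1 h2
    simp [exec, ha, hm, h1, h2, h1', h2', hs, ht, h9, hτ'.marks]
  · have h1' : τ.mem (B + ix (dropCoord f x).1) = 0 := not_not.1 h1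
    have h2' : τ.mem (B + ix (dropCoord f x).2) ≠ 0 := h2
    simp [exec, ha, hm, h1, h2, h1', h2', hs, ht, h9, hτ'.marks]
  · have h1' : τ.mem (B + ix (dropCoord f x).1) = 0 := not_not.1 h1
    have h2' : τ.mem (B + ix (dropCoord f x).2) = 0 := not_not.1 h2
    simp [exec, hm, h1, h2, h1', h2', hs, ht, h9, hτ'.marks]

theorem exec_initMarks {v : U} {σ : State} (hσ : Ready s B σ) (hv : σ.reg 14 = ix v) :
    memGraph ix B (initMarks.exec σ).mem = memGraph ix B σ.mem ∧
      memSet ix B (initMarks.exec σ).mem = {v} := by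
  rw [initMarks, exec]
  have h := exec_forTo ix (i := 13) (n := 0) (c := add 9 5 13 ;; const 7 0 ;; store 9 7)
    (acc := 4) hσ.size (by decide)
    (fun D m _ => memGraph ix B m = memGraph ix B σ.mem ∧ ∀ u ∈ D, u ∉ memSet ix B m)
    (by simp) ?_
  · have hτ := hσ.exec (c := forTo 13 0 (add 9 5 13 ;; const 7 0 ;; store 9 7)) (by decide)
    have h14 : ((forTo 13 0 (add 9 5 13 ;; const 7 0 ;; store 9 7)).exec σ).reg 14 = ix v := by
      rw [exec_reg (by decide), hv]
    generalize (forTo 13 0 (add 9 5 13 ;; const 7 0 ;; store 9 7)).exec σ = τ at *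
    have hm : ((add 9 5 14 ;; store 9 2).exec τ).mem = Function.update τ.mem (B + ix v) 1 := by
      simp [exec, hτ.marks, hτ.one, h14]
    rw [hm]
    refine ⟨memGraph_update_mark.trans h.1, ?_⟩
    ext u
    simp [mem_memSet_update, h.2]
  · intro D u τ _ hI hu hτ
    have h5 : τ.reg 5 = B := by rw [hτ 5 (by decide) (by decide), hσ.marks]
    have hm : ((add 9 5 13 ;; const 7 0 ;; store 9 7).exec τ).mem =
        Function.update τ.mem (B + ix u) 0 := by
      simp [exec, h5, hu]
    rw [hm]
    refine ⟨memGraph_update_mark.trans hI.1, ?_⟩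
    intro w hw
    rw [mem_memSet_update]
    by_cases hwu : w = u
    · simp [hwu]
    · simp [hwu, hI.2 w (hw.resolve_left hwu)]

/-- One round of propagation marks at least the successors of all marked vertices, and only
reachable vertices. -/
theorem exec_forTriple_propagate {v : U} {f : Fin 3} {σ : State} {G : Graph3D U}
    (hσ : Ready s B σ) (hG : memGraph ix B σ.mem = G)
    (hsub : memSet ix B σ.mem ⊆ G.reachSet f v) :
    memGraph ix B ((forTriple 10 11 12 (propagate f)).exec σ).mem = G ∧
      memSet ix B σ.mem ⊆ memSet ix B ((forTriple 10 11 12 (propagate f)).exec σ).mem ∧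
      memSet ix B ((forTriple 10 11 12 (propagate f)).exec σ).mem ⊆ G.reachSet f v ∧
      ∀ x ∈ G, (dropCoord f x).1 ∈ memSet ix B σ.mem →
        (dropCoord f x).2 ∈ memSet ix B ((forTriple 10 11 12 (propagate f)).exec σ).mem := by
  have h := exec_forTriple_holds (ix := ix) (c := propagate f) hσ (by clear * -; revert f; decide)
    (fun D m _ => memGraph ix B m = G ∧ memSet ix B σ.mem ⊆ memSet ix B m ∧
      memSet ix B m ⊆ G.reachSet f v ∧
      ∀ x ∈ D, x ∈ G → (dropCoord f x).1 ∈ memSet ix B σ.mem →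
        (dropCoord f x).2 ∈ memSet ix B m) ⟨hG, subset_rfl, hsub, by simp⟩ ?_
  · simpa using h
  · rintro D x τ hτ hx ⟨h1, h2, h3, h4⟩ -
    rw [exec_propagate_mem hτ hx f, h1]
    split_ifs with hc
    · have hle : memSet ix B τ.mem ⊆
          memSet ix B (Function.update τ.mem (B + ix (dropCoord f x).2) 1) := by
        intro w hw
        rw [mem_memSet_update]
        tauto
      refine ⟨memGraph_update_mark.trans h1, h2.trans hle, ?_, ?_⟩
      · intro w hw
        rcases mem_memSet_update.1 hw with ⟨rfl, -⟩ | ⟨-, hw⟩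
        · exact reachSet_closed hc.1 (h3 hc.2)
        · exact h3 hw
      · rintro y (rfl | hy) hyG hyM
        · exact mem_memSet_update.2 (.inl ⟨rfl, one_ne_zero⟩)
        · exact hle (h4 y hy hyG hyM)
    · refine ⟨h1, h2, h3, ?_⟩
      rintro y (rfl | hy) hyG hyM
      · exact absurd ⟨hyG, h2 hyM⟩ hc
      · exact h4 y hy hyG hyM

/-- The marks spread to all reachable vertices, since each round adds a new one as long as some
are missing. -/
theorem exec_forTo_propagate {v : U} {f : Fin 3} {σ : State} (hσ : Ready s B σ)
    (hM : memSet ix B σ.mem = {v}) :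
    memGraph ix B ((forTo 15 0 (forTriple 10 11 12 (propagate f))).exec σ).mem =
        memGraph ix B σ.mem ∧
      memSet ix B ((forTo 15 0 (forTriple 10 11 12 (propagate f))).exec σ).mem =
        (memGraph ix B σ.mem).reachSet f v := by
  have : Finite U := .of_equiv _ ix.symm
  set G := memGraph ix B σ.mem with hG
  have h := exec_forTo ix (i := 15) (n := 0) (c := forTriple 10 11 12 (propagate f)) (acc := 4)
    hσ.size (by decide)
    (fun D m _ => memGraph ix B m = G ∧ v ∈ memSet ix B m ∧ memSet ix B m ⊆ G.reachSet f v ∧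
      (G.reachSet f v ⊆ memSet ix B m ∨ D.ncard < (memSet ix B m).ncard))
    ⟨rfl, by simp [hM], by simp [hM, mem_reachSet_self], .inr (by simp [hM])⟩ ?_
  · obtain ⟨h1, -, h3, h4⟩ := h
    refine ⟨h1, h3.antisymm (h4.resolve_right ?_)⟩
    exact not_lt.2 (Set.ncard_le_ncard (Set.subset_univ _))
  · rintro D u τ hu ⟨h1, h2, h3, h4⟩ - hτ
    have hR : Ready s B τ := hσ.of_eq fun r hr => hτ r (by rintro rfl; simp at hr)
      (by clear * - hr; revert f r; decide)
    obtain ⟨k1, k2, k3, k4⟩ := exec_forTriple_propagate hR h1 h3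
    refine ⟨k1, k2 h2, k3, ?_⟩
    by_cases hc : G.reachSet f v ⊆ memSet ix B τ.mem
    · exact .inl (hc.trans k2)
    right
    have hlt := h4.resolve_left hc
    have : ∃ x ∈ G, (dropCoord f x).1 ∈ memSet ix B τ.mem ∧
        (dropCoord f x).2 ∉ memSet ix B τ.mem := by
      by_contra! hcl
      exact hc (reachSet_subset h2 hcl)
    obtain ⟨x, hxG, hx1, hx2⟩ := this
    have hss : memSet ix B τ.mem ⊂
        memSet ix B ((forTriple 10 11 12 (propagate f)).exec τ).mem :=
      (Set.ssubset_iff_of_subset k2).2 ⟨_, k4 x hxG hx1, hx2⟩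
    have := Set.ncard_lt_ncard hss
    have := Set.ncard_insert_le u D
    omega

theorem exec_forTriple_cutTriple {f : Fin 3} {σ : State} (hσ : Ready s B σ) :
    memGraph ix B ((forTriple 10 11 12 (cutTriple f)).exec σ).mem =
      (memGraph ix B σ.mem).deleteCut f (memSet ix B σ.mem) := by
  have h := exec_forTriple_holds (ix := ix) (c := cutTriple f) hσ (by clear * -; revert f; decide)
    (fun D m _ => memSet ix B m = memSet ix B σ.mem ∧
      ∀ x, x ∈ memGraph ix B m ↔ x ∈ memGraph ix B σ.mem ∧ (x ∈ D →
        ((dropCoord f x).1 ∈ memSet ix B σ.mem ↔ (dropCoord f x).2 ∈ memSet ix B σ.mem)))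
    (by simp) ?_
  · ext x
    rw [h.2 x, mem_deleteCut]
    simp
  · rintro D x τ hτ hx ⟨h1, h2⟩ -
    rw [exec_cutTriple_mem hτ hx f, h1]
    split_ifs with hc
    · refine ⟨h1, fun y => ?_⟩
      rw [h2 y]
      by_cases hy : y = x
      · subst hy
        simp [hc]
      · simp [hy]
    · refine ⟨memSet_update_code.trans h1, fun y => ?_⟩
      rw [mem_memGraph_update]
      by_cases hy : y = x
      · subst hy
        simp [hc]
      · simp [hy, h2 y]

theorem exec_cutReachable {f : Fin 3} {v : U} {σ : State} (hσ : Ready s B σ)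
    (hv : σ.reg 14 = ix v) :
    memGraph ix B ((cutReachable f).exec σ).mem =
      (memGraph ix B σ.mem).deleteCut f ((memGraph ix B σ.mem).reachSet f v) := by
  obtain ⟨h1, h2⟩ := exec_initMarks hσ hv
  have hσ₁ := hσ.exec (c := initMarks) (by decide)
  obtain ⟨h3, h4⟩ := exec_forTo_propagate (f := f) hσ₁ h2
  have hσ₂ := hσ₁.exec (c := forTo 15 0 (forTriple 10 11 12 (propagate f)))
    (by clear * -; revert f; decide)
  have h5 := exec_forTriple_cutTriple (ix := ix) (f := f) hσ₂
  rw [h3, h4, h1] at h5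
  exact h5

/-- A pass simplifies the 3D graph, and it changes the 3D graph unless this is stuck. -/
theorem exec_pass {σ : State} (hσ : Ready s B σ) :
    (memGraph ix B σ.mem).SimplifiesTo (memGraph ix B (pass.exec σ).mem) ∧
      (memGraph ix B (pass.exec σ).mem = memGraph ix B σ.mem →
        (memGraph ix B σ.mem).Stuck) := by
  set G := memGraph ix B σ.mem with hG
  have h := exec_forTo ix (i := 14) (n := 0)
    (c := cutReachable 0 ;; cutReachable 1 ;; cutReachable 2) (acc := 4) hσ.size (by decide)
    (fun D m _ => G.SimplifiesTo (memGraph ix B m) ∧ (memGraph ix B m = G →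
      ∀ v ∈ D, ∀ f, G.deleteCut f (G.reachSet f v) = G)) ⟨.refl, by simp⟩ ?_
  · exact ⟨h.1, fun heq => stuck_of_deleteCut_reachSet fun f v => h.2 heq v trivial f⟩
  · rintro D v τ - ⟨h1, h2⟩ hv hτ
    have hR : Ready s B τ := hσ.of_eq fun r hr => hτ r (by rintro rfl; simp at hr)
      (by revert r; decide)
    have e0 := exec_cutReachable (f := 0) hR hv
    have hR1 := hR.exec (c := cutReachable 0) (by decide)
    have hv1 : ((cutReachable 0).exec τ).reg 14 = ix v := by rw [exec_reg (by decide), hv]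
    have e1 := exec_cutReachable (f := 1) hR1 hv1
    have hR2 := hR1.exec (c := cutReachable 1) (by decide)
    have hv2 : ((cutReachable 1).exec ((cutReachable 0).exec τ)).reg 14 = ix v := by
      rw [exec_reg (by decide), hv1]
    have e2 := exec_cutReachable (f := 2) hR2 hv2
    simp only [exec]
    generalize memGraph ix B τ.mem = H at *
    generalize memGraph ix B ((cutReachable 0).exec τ).mem = H₀ at *
    generalize memGraph ix B ((cutReachable 1).exec ((cutReachable 0).exec τ)).mem = H₁ at *
    generalize memGraph ix B
      ((cutReachable 2).exec ((cutReachable 1).exec ((cutReachable 0).exec τ))).mem = H₂ at *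
    have s0 : H.SimplifiesTo H₀ := e0 ▸ simplifies_deleteCut_reachSet H 0 v
    have s1 : H₀.SimplifiesTo H₁ := e1 ▸ simplifies_deleteCut_reachSet H₀ 1 v
    have s2 : H₁.SimplifiesTo H₂ := e2 ▸ simplifies_deleteCut_reachSet H₁ 2 v
    refine ⟨((h1.trans s0).trans s1).trans s2, fun heq => ?_⟩
    -- Simplification only deletes edges, so the sequence of 3D graphs from `G` back to `G` is
    -- constant.
    have l1 : G ⊆ H₁ := heq ▸ s2.subset
    have l0 : G ⊆ H₀ := l1.trans s1.subset
    have hH : H = G := h1.subset.antisymm (l0.trans s0.subset)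
    have hH₀ : H₀ = G := (hH ▸ s0.subset).antisymm l0
    have hH₁ : H₁ = G := (hH₀ ▸ s1.subset).antisymm l1
    rw [hH, hH₀] at e0
    rw [hH₀, hH₁] at e1
    rw [hH₁, heq] at e2
    rintro w (rfl | hw) f
    · fin_cases f
      exacts [e0.symm, e1.symm, e2.symm]
    · exact h2 hH w hw f

/-- After `s ^ 3` passes the 3D graph is stuck, since each pass before that deletes an edge. -/
theorem exec_forTriple_pass {σ : State} (hσ : Ready s B σ) :
    (memGraph ix B σ.mem).SimplifiesTo
        (memGraph ix B ((forTriple 20 21 22 pass).exec σ).mem) ∧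
      (memGraph ix B ((forTriple 20 21 22 pass).exec σ).mem).Stuck := by
  have : Finite U := .of_equiv _ ix.symm
  have hle : (memGraph ix B σ.mem).ncard ≤ (Set.univ : Set (U × U × U)).ncard :=
    Set.ncard_le_ncard (Set.subset_univ _)
  have h := exec_forTriple ix (i₁ := 20) (i₂ := 21) (i₃ := 22) (c := pass) (acc := 4) (σ := σ)
    hσ.size (by decide) (by decide) (by decide) (by decide) (by decide) (by decide) (by decide)
    (by decide) (by decide) (by decide) (by decide) (by decide)
    (fun D m _ => (memGraph ix B σ.mem).SimplifiesTo (memGraph ix B m) ∧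
      ((memGraph ix B m).Stuck ∨
        D.ncard + (memGraph ix B m).ncard ≤ (Set.univ : Set (U × U × U)).ncard))
    ⟨.refl, .inr (by simpa using hle)⟩ ?_
  · refine ⟨h.1, h.2.elim id fun hle => ?_⟩
    have h0 : (memGraph ix B ((forTriple 20 21 22 pass).exec σ).mem).ncard = 0 := by omega
    rw [Set.ncard_eq_zero] at h0
    rw [h0]
    exact fun f S _ => Set.subset_empty_iff.1 (deleteCut_subset _ f S)
  · rintro D x τ hx ⟨h1, h2⟩ - - - hτ
    have hR : Ready s B τ := hσ.of_eq fun r hr => by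
      refine hτ r ?_ ?_ ?_ (by revert r; decide) <;> rintro rfl <;> simp at hr
    obtain ⟨h3, h4⟩ := exec_pass (ix := ix) hR
    refine ⟨h1.trans h3, ?_⟩
    by_cases heq : memGraph ix B (pass.exec τ).mem = memGraph ix B τ.mem
    · exact .inl (heq ▸ h4 heq)
    rcases h2 with h2 | h2
    · exact absurd (h3.subset.antisymm (h2.subset_of_simplifiesTo subset_rfl h3)) heq
    · right
      have := Set.ncard_lt_ncard (h3.subset.ssubset_of_ne heq)
      have := Set.ncard_insert_le x D
      omega

end Cmd

/-! ### The 3D graph of a puzzle -/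

namespace Cmd

variable {s k B : ℕ}

open Classical in
/-- `1` if the proposition holds and `0` otherwise -/
noncomputable def indicator (p : Prop) : ℕ := if p then 1 else 0

theorem exec_countSymbol {row c : ℕ} {σ : State} (h1 : σ.reg 1 = k) (h2 : σ.reg 2 = 1)
    (hrow : row ∈ [10, 11, 12]) :
    ((countSymbol row c).exec σ).mem = σ.mem ∧
      ((countSymbol row c).exec σ).reg 9 =
        σ.reg 9 + indicator (σ.mem (σ.reg row * k + σ.reg 13) = c) := by
  have hr : row ≠ 7 ∧ row ≠ 3 := by constructor <;> rintro rfl <;> simp at hrow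
  by_cases hc : σ.mem (σ.reg row * k + σ.reg 13) = c
  · simp [countSymbol, exec, exec_mul, hr, h1, h2, indicator, hc]
  · have hc' : σ.mem (σ.reg row * k + σ.reg 13) - c = 0 →
        c - σ.mem (σ.reg row * k + σ.reg 13) ≠ 0 := by omega
    by_cases hd : σ.mem (σ.reg row * k + σ.reg 13) - c = 0
    · simp [countSymbol, exec, exec_mul, hr, h1, indicator, hc, hd, hc' hd]
    · simp [countSymbol, exec, exec_mul, hr, h1, indicator, hc, hd]

theorem indicator_add_eq_two {a b c : Prop} :
    indicator a + indicator b + indicator c = 2 ↔ ExactlyTwo a b c := by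
  by_cases a <;> by_cases b <;> by_cases c <;> simp [indicator, ExactlyTwo, *]

open Classical in
theorem exec_testColumn {σ : State} (h1 : σ.reg 1 = k) (h2 : σ.reg 2 = 1) :
    (testColumn.exec σ).mem = σ.mem ∧ (testColumn.exec σ).reg 4 =
      if ExactlyTwo (σ.mem (σ.reg 10 * k + σ.reg 13) = 1) (σ.mem (σ.reg 11 * k + σ.reg 13) = 2)
        (σ.mem (σ.reg 12 * k + σ.reg 13) = 3) then 0 else σ.reg 4 := by
  have k0 := exec_reg (c := const 9 0) (r := 4) (by decide) σ
  rw [testColumn, exec]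
  have a1 := exec_countSymbol (row := 10) (c := 1) (σ := (const 9 0).exec σ) (k := k)
    (by simp [exec, h1]) (by simp [exec, h2]) (by simp)
  have f1 : ∀ r ∈ [1, 2, 4, 11, 12, 13], ((countSymbol 10 1).exec ((const 9 0).exec σ)).reg r =
      σ.reg r := fun r hr => by
    rw [exec_reg (by revert r; decide), exec_reg (by revert r; decide)]
  simp only [exec, State.setReg_mem, State.setReg_reg] at a1 f1 ⊢
  generalize (countSymbol 10 1).exec (σ.setReg 9 0) = σ₁ at *
  have a2 := exec_countSymbol (row := 11) (c := 2) (σ := σ₁) (k := k)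
    (by simp [f1, h1]) (by simp [f1, h2]) (by simp)
  have f2 : ∀ r ∈ [1, 2, 4, 12, 13], ((countSymbol 11 2).exec σ₁).reg r = σ.reg r :=
    fun r hr => by
      rw [exec_reg (by revert r; decide), f1 r (by revert r; decide)]
  generalize (countSymbol 11 2).exec σ₁ = σ₂ at *
  have a3 := exec_countSymbol (row := 12) (c := 3) (σ := σ₂) (k := k)
    (by simp [f2, h1]) (by simp [f2, h2]) (by simp)
  have f3 : ((countSymbol 12 3).exec σ₂).reg 4 = σ.reg 4 := by
    rw [exec_reg (by decide), f2 4 (by simp)]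
  generalize (countSymbol 12 3).exec σ₂ = σ₃ at *
  have h9 : σ₃.reg 9 = 2 ↔ ExactlyTwo (σ.mem (σ.reg 10 * k + σ.reg 13) = 1)
      (σ.mem (σ.reg 11 * k + σ.reg 13) = 2) (σ.mem (σ.reg 12 * k + σ.reg 13) = 3) := by
    rw [a3.2, a2.2, a1.2, ← indicator_add_eq_two]
    simp [a1.1, a2.1, f1, f2]
  rw [← h9]
  have hm : σ₃.mem = σ.mem := by rw [a3.1, a2.1, a1.1]
  by_cases h : σ₃.reg 9 = 2
  · simp [h, hm]
  · have : ¬ (σ₃.reg 9 - 2 = 0 ∧ 2 - σ₃.reg 9 = 0) := by omega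
    by_cases h' : 2 - σ₃.reg 9 = 0
    · have h'' : σ₃.reg 9 - 2 ≠ 0 := by omega
      simp [h, h', h'', hm, f3]
    · simp [h, h', hm, f3]

/-- The invariant of the outer loops keeps the puzzle, which occupies the addresses below `s * k`,
intact; that of the column loop says that register `4` is nonzero as long as no column excludes
the triple. -/
theorem exec_build {P : Puzzle s k} {e : P.rows ≃ Fin s} {σ : State}
    (hσ : Ready s (s * k) σ) (h1 : σ.reg 1 = k)
    (hm : ∀ (u : P.rows) (i : Fin k), σ.mem (e u * k + i) = (u.1 i : ℕ) + 1) :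
    memGraph e (s * k) (build.exec σ).mem = P.graph := by
  have h := exec_forTriple_holds (ix := e)
    (c := const 4 1 ;; forTo 13 1 testColumn ;; addr ;; store 8 4) hσ (by decide)
    (fun D m _ => (∀ n < s * k, m n = σ.mem n) ∧
      ∀ x ∈ D, x ∈ memGraph e (s * k) m ↔ x ∈ P.graph) (by simp) ?_
  · ext x
    exact h.2 x trivial
  rintro D x τ hτ hx ⟨hD, hG⟩ hτ1
  have h1 : τ.reg 1 = k := (hτ1 (by decide)).trans h1
  have hcell : ∀ (u : P.rows) (i : Fin k), τ.mem (e u * k + i) = (u.1 i : ℕ) + 1 := by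
    intro u i
    rw [hD _ ?_, hm]
    calc (e u : ℕ) * k + i < e u * k + k := by omega
      _ = (e u + 1) * k := by ring
      _ ≤ s * k := Nat.mul_le_mul_right k (e u).2
  have hedge : ∀ i : Fin k, ExactlyTwo (τ.mem (τ.reg 10 * k + i) = 1)
      (τ.mem (τ.reg 11 * k + i) = 2) (τ.mem (τ.reg 12 * k + i) = 3) ↔
      ExactlyTwo (x.1.1 i = 0) (x.2.1.1 i = 1) (x.2.2.1 i = 2) := by
    intro i
    have hsymb : ∀ a : Fin 3, ((a : ℕ) + 1 = 1 ↔ a = 0) ∧ ((a : ℕ) + 1 = 2 ↔ a = 1) ∧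
        ((a : ℕ) + 1 = 3 ↔ a = 2) := by decide
    rw [hx.fst, hx.snd, hx.trd, hcell, hcell, hcell, (hsymb _).1, (hsymb _).2.1, (hsymb _).2.2]
  have hτ' : Ready s (s * k) ((const 4 1).exec τ) := hτ.exec (by decide)
  have hx' : Holds e x ((const 4 1).exec τ) := hx.exec (by decide)
  have hloop := exec_forTo (Equiv.refl (Fin k)) (i := 13) (n := 1) (c := testColumn) (acc := 4)
    (σ := (const 4 1).exec τ) (by simp [exec, h1]) (by decide)
    (fun E m v => m = τ.mem ∧
      (v ≠ 0 ↔ ∀ i ∈ E, ¬ ExactlyTwo (x.1.1 i = 0) (x.2.1.1 i = 1) (x.2.2.1 i = 2)))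
    (by simp [exec]) ?_
  · have hτ₂ := hτ'.exec (c := forTo 13 1 testColumn) (by decide)
    have hx₂ := hx'.exec (c := forTo 13 1 testColumn) (by decide)
    rw [exec_seq, exec_seq, exec_seq]
    generalize (forTo 13 1 testColumn).exec ((const 4 1).exec τ) = τ₂ at *
    have h4 : (addr.exec τ₂).reg 4 = τ₂.reg 4 := exec_reg (by decide) τ₂
    rw [exec, exec_addr_reg hτ₂ hx₂, h4, State.setMem_mem, exec_addr_mem, hloop.1]
    refine ⟨fun n hn => ?_, fun y hy => ?_⟩
    · rw [Function.update_of_ne (by omega), hD n hn]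
    · rw [mem_memGraph_update, hloop.2]
      by_cases hyx : y = x
      · simp [hyx, Puzzle.graph]
      · simp [hyx, hG y (hy.resolve_left hyx)]
  · rintro E i ρ - ⟨hρm, hρ4⟩ hi hρ
    have hr : ∀ r ∈ [1, 2, 10, 11, 12], ρ.reg r = τ.reg r := fun r hr => by
      rw [hρ r (by rintro rfl; simp at hr) (by clear * - hr; revert r; decide),
        exec_reg (by clear * - hr; revert r; decide)]
    obtain ⟨t1, t2⟩ := exec_testColumn (σ := ρ) (k := k) (by rw [hr 1 (by simp), h1])
      (by rw [hr 2 (by simp), hτ.one])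
    rw [hr 10 (by simp), hr 11 (by simp), hr 12 (by simp), hi, hρm] at t2
    refine ⟨t1.trans hρm, ?_⟩
    rw [t2, Set.forall_mem_insert, ← hρ4, ← hedge i]
    simp only [Equiv.refl_apply]
    split_ifs with h <;> simp [h]

/-! ### The answer -/

open Classical in
/-- The four truncated differences in `testDiagonal` add up to `0` exactly on the diagonal. -/
theorem exec_testDiagonal {U : Type*} {ix : U ≃ Fin s} {x : U × U × U} {τ : State}
    (hτ : Ready s B τ) (hx : Holds ix x τ) :
    (testDiagonal.exec τ).mem = τ.mem ∧ (testDiagonal.exec τ).reg 4 =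
      if x ∈ memGraph ix B τ.mem ∧ x ∉ trivialMatching U then 0 else τ.reg 4 := by
  have hx' := hx.exec (c := addr) (by decide)
  have ha := exec_addr_reg hτ hx
  have hm := exec_addr_mem τ
  have h4 : (addr.exec τ).reg 4 = τ.reg 4 := exec_reg (by decide) τ
  have hT : x ∈ trivialMatching U ↔ (ix x.1 : ℕ) = ix x.2.1 ∧ (ix x.2.1 : ℕ) = ix x.2.2 := by
    obtain ⟨a, b, c⟩ := x
    simp only [Fin.val_inj, ix.apply_eq_iff_eq]
    constructor
    · rintro ⟨u, hu⟩
      cases hu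
      exact ⟨rfl, rfl⟩
    · rintro ⟨rfl, rfl⟩
      exact ⟨a, rfl⟩
  rw [testDiagonal, exec, hT]
  generalize addr.exec τ = τ' at *
  by_cases h1 : x ∈ memGraph ix B τ.mem
  · have h1' : τ.mem (B + s + code ix x) ≠ 0 := h1
    have hz : (ix x.1 : ℕ) - ix x.2.1 + (ix x.2.1 - ix x.1) + (ix x.2.1 - ix x.2.2) +
        (ix x.2.2 - ix x.2.1) = 0 ↔ (ix x.1 : ℕ) = ix x.2.1 ∧ (ix x.2.1 : ℕ) = ix x.2.2 := by
      omega
    rw [← hz]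
    generalize hd : (ix x.1 : ℕ) - ix x.2.1 + (ix x.2.1 - ix x.1) + (ix x.2.1 - ix x.2.2) +
      (ix x.2.2 - ix x.2.1) = d
    by_cases h2 : d = 0
    · simp [exec, ha, hm, hx'.fst, hx'.snd, hx'.trd, h1', hd, h2, h4, -Nat.add_eq_zero_iff]
    · simp [exec, ha, hm, hx'.fst, hx'.snd, hx'.trd, h1, h1', hd, h2, -Nat.add_eq_zero_iff]
  · have h1' : τ.mem (B + s + code ix x) = 0 := not_not.1 h1
    simp [exec, ha, hm, h1, h1', h4]

open Classical in
theorem exec_forTriple_testDiagonal {U : Type*} {ix : U ≃ Fin s} {σ : State}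
    (hσ : Ready s B σ) (h4 : σ.reg 4 = 1) :
    ((forTriple 10 11 12 testDiagonal).exec σ).reg 4 =
      if memGraph ix B σ.mem ⊆ trivialMatching U then 1 else 0 := by
  have h := exec_forTriple_holds (ix := ix) (c := testDiagonal) hσ (by decide)
    (fun D m v => m = σ.mem ∧
      v = if ∀ x ∈ D, x ∈ memGraph ix B σ.mem → x ∈ trivialMatching U then 1 else 0)
    (by simp [h4]) ?_
  · simpa [Set.subset_def] using h.2
  · rintro D x τ hτ hx ⟨hm, hv⟩ -
    obtain ⟨t1, t2⟩ := exec_testDiagonal hτ hx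
    refine ⟨t1.trans hm, ?_⟩
    rw [t2, hv, hm]
    simp only [Set.forall_mem_insert]
    split_ifs <;> tauto

end Cmd

end RAM

/-- In a triple `(u, u, u)` at most one of `u_i = 1`, `u_i = 2`, `u_i = 3` holds, so it is always
an edge. -/
theorem Puzzle.trivialMatching_subset_graph {s k : ℕ} (P : Puzzle s k) :
    Graph3D.trivialMatching P.rows ⊆ P.graph := by
  rintro _ ⟨u, rfl⟩ ⟨i, hi⟩
  simp only [ExactlyTwo] at hi
  generalize u.1 i = a at hi
  revert hi
  fin_cases a <;> simp

theorem Puzzle.input_mem {s k : ℕ} (P : Puzzle s k) (e : Fin s ≃ P.rows) (u : P.rows)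
    (i : Fin k) : (P.input e).mem (e.symm u * k + i) = (u.1 i : ℕ) + 1 := by
  have hk : 0 < k := i.pos
  have hlt : (e.symm u : ℕ) * k + i < s * k :=
    calc (e.symm u : ℕ) * k + i < e.symm u * k + k := by omega
      _ = (e.symm u + 1) * k := by ring
      _ ≤ s * k := Nat.mul_le_mul_right k (e.symm u).2
  have hdiv : ((e.symm u : ℕ) * k + i) / k = e.symm u := by
    rw [Nat.mul_comm, Nat.mul_add_div hk, Nat.div_eq_of_lt i.2, Nat.add_zero]
  have hmod : ((e.symm u : ℕ) * k + i) % k = i := by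
    rw [Nat.mul_comm, Nat.mul_add_mod, Nat.mod_eq_of_lt i.2]
  simp only [Puzzle.input, hlt, dif_pos, hdiv, hmod, Fin.eta, Equiv.apply_symm_apply]

open RAM Cmd in
open Classical in
/-- The answer is correct for the input with the constant `1` put into register `2`, as compiled
loops require. -/
theorem RAM.Cmd.exec_decideSimplifiable {s k : ℕ} (P : Puzzle s k) (e : Fin s ≃ P.rows) :
    (decideSimplifiable.exec ((P.input e).setReg 2 1)).reg 4 =
      if P.IsSimplifiableSUSP then 1 else 0 := by
  set σ := (P.input e).setReg 2 1 with hσ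
  have r0 : σ.reg 0 = s := by simp [hσ, Puzzle.input]
  have r1 : σ.reg 1 = k := by simp [hσ, Puzzle.input]
  have r2 : σ.reg 2 = 1 := by simp [hσ]
  simp only [decideSimplifiable, exec_seq]
  have hR : Ready s (s * k) ((add 6 5 0).exec ((mul 5 0 1).exec σ)) := by
    constructor <;> simp [exec, exec_mul, r0, r1, r2]
  have hr1 : ((add 6 5 0).exec ((mul 5 0 1).exec σ)).reg 1 = k := by
    simp [exec, exec_mul, r1]
  have hm : ((add 6 5 0).exec ((mul 5 0 1).exec σ)).mem = (P.input e).mem := by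
    simp [exec, exec_mul, hσ]
  generalize (add 6 5 0).exec ((mul 5 0 1).exec σ) = σ₁ at *
  have hG := exec_build (P := P) (e := e.symm) hR hr1 (by rw [hm]; exact P.input_mem e)
  have hR' := hR.exec (c := build) (by decide)
  generalize build.exec σ₁ = σ₂ at *
  obtain ⟨h1, h2⟩ := exec_forTriple_pass (ix := e.symm) hR'
  have hR'' := hR'.exec (c := forTriple 20 21 22 pass) (by decide)
  generalize (forTriple 20 21 22 pass).exec σ₂ = σ₃ at *
  rw [exec_forTriple_testDiagonal (ix := e.symm) (hR''.exec (c := const 4 1) (by decide))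
    (by simp [exec])]
  rw [hG] at h1
  have := Graph3D.simplifiesTo_trivialMatching_iff P.trivialMatching_subset_graph h1 h2
  rw [Puzzle.IsSimplifiableSUSP, this]
  rfl

theorem mainTheorem2 :
    ∃ (alg : RAM.Program) (p : MvPolynomial (Fin 2) ℕ),
      ∀ (s k : ℕ) (P : Puzzle s k) (e : Fin s ≃ P.rows),
        ∃ (t : ℕ) (τ : RAM.State),
          RAM.Run alg (P.input e) t τ ∧
          t ≤ MvPolynomial.eval ![s, k] p ∧
          (P.IsSimplifiableSUSP → τ.reg 0 = 1) ∧
          (¬ P.IsSimplifiableSUSP → τ.reg 0 = 0) := by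
  refine ⟨.seq (.const 2 1) (.seq RAM.Cmd.decideSimplifiable.compile
    (.seq (.const 0 0) (.add 0 0 4))), RAM.Cmd.decideSimplifiable.cost + 3, fun s k P e => ?_⟩
  obtain ⟨t, ht, hrun⟩ := RAM.Cmd.run_compile (c := RAM.Cmd.decideSimplifiable) (by decide)
    (by decide) (by decide) (by decide) ((P.input e).setReg 2 1) (by simp)
  have hans := RAM.Cmd.exec_decideSimplifiable P e
  refine ⟨_, _, .seq (.const 2 1 _) (.seq hrun (.seq (.const 0 0 _) (.add 0 0 4 _))), ?_, ?_, ?_⟩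
  · have hv : ![((P.input e).setReg 2 1).reg 0, ((P.input e).setReg 2 1).reg 1] = ![s, k] := by
      simp [Puzzle.input]
    rw [hv] at ht
    simp only [map_add, map_ofNat]
    omega
  · intro h
    simpa [h] using hans
  · intro h
    simpa [h] using hans
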